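/- Let $n\ge 2$ and $p\ge 1$ be integers. For every integer $k\ge 0$ let $Y_{k,1},\dots,Y_{k,a_k}$ be an orthonormal basis, with respect to the surface measure $d\theta$ on $\mathbb{S}^{n-1}\subset\mathbb{R}^n$, of the space of real spherical harmonics of degree $k$. For $k\ge 0$ let $\Lambda_k=[\lambda_1,\dots,\lambda_{2p}]$ consist of the numbers $k+2j$ and $-n-k+2+2j$, $j=0,\dots,p-1$. Let $\phi_k$ be the TB-spline with frequencies $\Lambda_k$, i.e. the continuous function, supported in $[0,2p]$, with Fourier transform $$\widehat{\phi_k}(\xi)=\int_{\mathbb R} e^{-i\xi t}\phi_k(t)\,dt=\prod_{j=1}^{2p}\frac{e^{-\lambda_j}-e^{-i\xi}}{i\xi-\lambda_j},\qquad\text{put}\qquad \phi_k^*(\xi)=\sum_{j\in\mathbb Z}\phi_k(j)e^{-i\xi j},$$ and let $$\widetilde S_0^{(k)}(v)=\frac1{2\pi}\int_{\mathbb R}e^{i\xi v}\,\frac{\widehat{\phi_k}(\xi)}{\phi_k^*(\xi)}\,d\xi,\qquad S_0^{(k)}(r)=\widetilde S_0^{(k)}(\log r)\quad(r>0)$$ be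 the Shannon–Walter exponential spline. The Shannon polyspline kernel is $$S_0(r,\theta,\psi)=\sum_{k=0}^\infty\sum_{\ell=1}^{a_k}S_0^{(k)}(r)\,Y_{k,\ell}(\theta)\,Y_{k,\ell}(\psi),\qquad r>0,\ \theta,\psi\in\mathbb{S}^{n-1},$$ where the series is understood in the distributional sense, i.e. it is integrated term by term against a test function of $\theta$ (for fixed $r,\psi$) or of $\psi$ (for fixed $r,\theta$). For $s\in\mathbb R$, the Sobolev space $H^s(\mathbb{S}^{n-1})$ consists of the generalized functions $h=\sum_{k,\ell}h_{k,\ell}Y_{k,\ell}$ with $\sum_{k,\ell}(1+k^2)^s|h_{k,\ell}|^2<\infty$; the pairing of such an $h$ with a function $g\in L^2(\mathbb{S}^{n-1})\cap H^{-s}(\mathbb{S}^{n-1})$ is $\int h g\,d\theta=\sum_{k,\ell}h_{k,\ell}g_{k,\ell}$, where $g_{k,\ell}=\int g\,Y_{k,\ell}\,d\theta$. Then for every $r>0$ and every $\varepsilon>0$, with $s=-n+\frac32-\varepsilon$, $$S_0(r,\cdot,\psi)\in H^s(\mathbb{S}^{n-1})\ \text{ for every }\psi\in\mathbb{S}^{n-1},\qquad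 S_0(r,\theta,\cdot)\in H^s(\mathbb{S}^{n-1})\ \text{ for every }\theta\in\mathbb{S}^{n-1}.$$ -/

import Mathlib

open MeasureTheory
open scoped BigOperators

noncomputable section

/-! ### Exponential splines on the line -/

/-- The inverse Fourier transform for the convention `f̂ ξ = ∫ e^{-iξt} f t dt`. -/
def invFourier (F : ℝ → ℂ) (t : ℝ) : ℂ :=
  (1 / (2 * (Real.pi : ℂ))) * ∫ ξ : ℝ, Complex.exp (Complex.I * ξ * t) * F ξ

/-- The Fourier transform `∏ⱼ (e^{-λⱼ} - e^{-iξ}) / ∏ⱼ (iξ - λⱼ)` of the TB-spline with frequencies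
`Λ = (λⱼ)ⱼ`. The quotient is undefined (and set to `0` here) at most at the single point `ξ = 0`. -/
def tbSplineHat {ι : Type*} [Fintype ι] (Λ : ι → ℝ) (ξ : ℝ) : ℂ :=
  (∏ j, (Complex.exp (-(Λ j : ℂ)) - Complex.exp (-(Complex.I * ξ)))) /
    ∏ j, (Complex.I * ξ - (Λ j : ℂ))

/-- The TB-spline `φ = Q_N[Λ]`, supported in `[0, N]`, where `N` is the number of frequencies.
It is continuous for `N ≥ 2`. -/
def tbSpline {ι : Type*} [Fintype ι] (Λ : ι → ℝ) : ℝ → ℂ :=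
  invFourier (tbSplineHat Λ)

/-- `φ^*(ξ) = ∑_{j ∈ ℤ} φ(j) e^{-iξj}`. -/
def tbSymbol {ι : Type*} [Fintype ι] (Λ : ι → ℝ) (ξ : ℝ) : ℂ :=
  ∑' j : ℤ, tbSpline Λ (j : ℝ) * Complex.exp (-(Complex.I * ξ * j))

/-- The Shannon–Walter exponential spline, the function with Fourier transform `φ̂ / φ^*`. -/
def shannonWalter {ι : Type*} [Fintype ι] (Λ : ι → ℝ) : ℝ → ℂ :=
  invFourier (fun ξ => tbSplineHat Λ ξ / tbSymbol Λ ξ)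

/-- The `2p` frequencies `k + 2j` and `-n - k + 2 + 2j`, `j = 0, …, p - 1`: the roots of the
polynomial `M_{k,p}(z) = ∏ⱼ (z - k - 2j) (z + n + k - 2 - 2j)`. -/
def polysplineFreq (n p k : ℕ) : Fin p ⊕ Fin p → ℝ :=
  Sum.elim (fun j => (k : ℝ) + 2 * ((j : ℕ) : ℝ))
    (fun j => -(n : ℝ) - (k : ℝ) + 2 + 2 * ((j : ℕ) : ℝ))

/-- `S_0^{(k)}(r)`, the Shannon–Walter spline for `polysplineFreq n p k` at `log r`. -/
def radialShannon (n p k : ℕ) (r : ℝ) : ℂ :=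
  shannonWalter (polysplineFreq n p k) (Real.log r)

/-! ### Spherical harmonics -/

/-- The unit sphere `𝕊^{n-1}` of `ℝⁿ`. -/
abbrev UnitSphere (n : ℕ) : Type :=
  Metric.sphere (0 : EuclideanSpace ℝ (Fin n)) 1

/-- The surface area measure on the unit sphere. -/
def sphereMeasure (n : ℕ) : Measure (UnitSphere n) :=
  (volume : Measure (EuclideanSpace ℝ (Fin n))).toSphere

/-- The functions on the sphere that are restrictions of harmonic homogeneous polynomials of
degree `k`. -/
def sphericalHarmonics (n k : ℕ) : Set (UnitSphere n → ℝ) :=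
  {f | ∃ P : MvPolynomial (Fin n) ℝ, P.IsHomogeneous k ∧
    ∑ i, MvPolynomial.pderiv i (MvPolynomial.pderiv i P) = 0 ∧
    ∀ θ : UnitSphere n, f θ = MvPolynomial.eval (fun i => θ.1 i) P}

/-- For every `k`, the functions `Y k 0, …, Y k (a k - 1)` are an orthonormal basis of the
spherical harmonics of degree `k`. -/
structure IsSphericalHarmonicBasis (n : ℕ) (a : ℕ → ℕ)
    (Y : (k : ℕ) → Fin (a k) → UnitSphere n → ℝ) : Prop where
  span_eq : ∀ k, (Submodule.span ℝ (Set.range (Y k)) : Set (UnitSphere n → ℝ)) =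
    sphericalHarmonics n k
  orthonormal : ∀ k (l₁ l₂ : Fin (a k)),
    ∫ θ, Y k l₁ θ * Y k l₂ θ ∂(sphereMeasure n) = if l₁ = l₂ then 1 else 0

variable {n : ℕ} {a : ℕ → ℕ}

/-- The coefficient `g_{k,ℓ} = ∫ g Y_{k,ℓ}` of a function on the sphere. -/
def sphereCoeff (Y : (k : ℕ) → Fin (a k) → UnitSphere n → ℝ) (g : UnitSphere n → ℂ)
    (q : Σ k, Fin (a k)) : ℂ :=
  ∫ θ, g θ * (Y q.1 q.2 θ : ℂ) ∂(sphereMeasure n)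

/-- The square of the weighted `ℓ²`-norm `∑_{k,ℓ} (1 + k²)^s |h_{k,ℓ}|²` is finite. -/
def SobolevSummable (s : ℝ) (h : (Σ k, Fin (a k)) → ℂ) : Prop :=
  Summable fun q : Σ k, Fin (a k) => (1 + (q.1 : ℝ) ^ 2) ^ s * ‖h q‖ ^ 2

/-- A generalised function on the sphere, given by its action `g ↦ T g = ∫ T(θ) g(θ) dθ`,
belongs to `H^s(𝕊^{n-1})`: it is the sum of a series `∑ h_{k,ℓ} Y_{k,ℓ}` with
`∑ (1 + k²)^s |h_{k,ℓ}|² < ∞`. The sum is understood in the distributional sense, that is, by means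
of the bilinear pairing `∑ h_{k,ℓ} g_{k,ℓ}` with the functions `g` in `L²` and `H^{-s}`; for `s ≤ 0`
these `g` are all of `H^{-s}`. Only the action of `T` on these functions matters. -/
def MemSphereSobolev (Y : (k : ℕ) → Fin (a k) → UnitSphere n → ℝ) (s : ℝ)
    (T : (UnitSphere n → ℂ) → ℂ) : Prop :=
  ∃ h : (Σ k, Fin (a k)) → ℂ, SobolevSummable s h ∧
    ∀ g : UnitSphere n → ℂ, MemLp g 2 (sphereMeasure n) →
      SobolevSummable (-s) (sphereCoeff Y g) →
        HasSum (fun q => h q * sphereCoeff Y g q) (T g)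

/-! ### The Shannon polyspline kernel -/

/-- The term of degree `k` of the kernel, `∑_ℓ S_0^{(k)}(r) Y_{k,ℓ}(θ) Y_{k,ℓ}(ψ)`. -/
def shannonTerm (p : ℕ) (Y : (k : ℕ) → Fin (a k) → UnitSphere n → ℝ) (r : ℝ) (k : ℕ)
    (θ ψ : UnitSphere n) : ℂ :=
  ∑ l : Fin (a k), radialShannon n p k r * (Y k l θ : ℂ) * (Y k l ψ : ℂ)

/-- The kernel `S_0(r, ·, ψ) = ∑_k ∑_ℓ S_0^{(k)}(r) Y_{k,ℓ}(·) Y_{k,ℓ}(ψ)` as a generalised function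
of its first spherical variable: the series is integrated term by term against `g`. -/
def shannonKernelFst (p : ℕ) (Y : (k : ℕ) → Fin (a k) → UnitSphere n → ℝ) (r : ℝ)
    (ψ : UnitSphere n) (g : UnitSphere n → ℂ) : ℂ :=
  ∑' k : ℕ, ∫ θ, shannonTerm p Y r k θ ψ * g θ ∂(sphereMeasure n)

/-- The kernel `S_0(r, θ, ·)` as a generalised function of its second spherical variable. -/
def shannonKernelSnd (p : ℕ) (Y : (k : ℕ) → Fin (a k) → UnitSphere n → ℝ) (r : ℝ)
    (θ : UnitSphere n) (g : UnitSphere n → ℂ) : ℂ :=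
  ∑' k : ℕ, ∫ ψ, shannonTerm p Y r k θ ψ * g ψ ∂(sphereMeasure n)

end

/-! The coefficients of the kernel in one spherical variable are `S_0^{(k)}(r) Y_{k,ℓ}(ψ)`, so the
claim reduces to the convergence of `∑_k (1 + k²)^s |S_0^{(k)}(r)|² ∑_ℓ Y_{k,ℓ}(ψ)²`. Two estimates,
one radial and one angular, give it.

Radial: `|S_0^{(k)}(r)| ≤ 2` for all large `k`, uniformly in `r`
(`exists_forall_norm_radialShannon_le`). Put `Q(ξ) = ∏ⱼ (iξ - λⱼ)⁻¹`. By Poisson summation the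
symbol is the `2π`-periodization of the Fourier transform of the TB-spline. The numerator of that
transform is `2π`-periodic and cancels, which leaves `Q(ξ) / ∑_m Q(ξ + 2πm)`. Pairing the
frequencies `k + 2j` and `-(n + k - 2 - 2j)` gives factors `-(ξ² + AB - iξ(B - A))` with `A, B` of
size `k` and `B - A` bounded. So for large `k` the function `Q` is a positive function `M` times a
nearly constant phase. No cancellation occurs in the sum, and the quotient is at most `2 M(ξ) / ∑_m
M(ξ + 2πm)`, where the integral of `M / ∑ M` is at most `2π`.

Angular: by rotation invariance `∑_ℓ Y_{k,ℓ}(ψ)²` is independent of `ψ`, hence equals `a_k` divided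
by the area of the sphere (`sum_sq_mul_measure`), and `a_k ≤ 2 (k + 1)^{n-2}` (`card_le`).

The degree `k` term is therefore `O(k^{2s + n - 2})`, and `2s + n - 2 = -n + 1 - 2ε ≤ -1 - 2ε`
because `n ≥ 2`. -/

section RadialPart

open Filter Topology Asymptotics FourierTransform

/-! ### Decay of the spline's Fourier transform and Poisson summation -/

/-- `f` is smooth and all its derivatives are dominated by multiples of `w`. -/
def DerivsDominated (f : ℝ → ℂ) (w : ℝ → ℝ) : Prop :=
  ContDiff ℝ (⊤ : ℕ∞) f ∧ ∀ n : ℕ, ∃ C : ℝ, ∀ x, ‖iteratedDeriv n f x‖ ≤ C * w x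

theorem DerivsDominated.mul {f g : ℝ → ℂ} {v w : ℝ → ℝ} (hf : DerivsDominated f v)
    (hg : DerivsDominated g w) :
    DerivsDominated (fun x => f x * g x) (fun x => v x * w x) := by
  refine ⟨hf.1.mul hg.1, fun n => ?_⟩
  choose C hC using hf.2
  choose D hD using hg.2
  refine ⟨∑ i ∈ Finset.range (n + 1), (n.choose i : ℝ) * C i * D (n - i), fun x => ?_⟩
  rw [← norm_iteratedFDeriv_eq_norm_iteratedDeriv]
  refine (norm_iteratedFDeriv_mul_le hf.1 hg.1 x (n := n) (by exact_mod_cast le_top)).trans ?_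
  rw [Finset.sum_mul]
  refine Finset.sum_le_sum fun i _ => ?_
  rw [norm_iteratedFDeriv_eq_norm_iteratedDeriv, norm_iteratedFDeriv_eq_norm_iteratedDeriv]
  have h1 := mul_le_mul (hC i x) (hD (n - i) x) (norm_nonneg _) ((norm_nonneg _).trans (hC i x))
  calc _ = (n.choose i : ℝ) * (‖iteratedDeriv i f x‖ * ‖iteratedDeriv (n - i) g x‖) := by ring
    _ ≤ (n.choose i : ℝ) * ((C i * v x) * (D (n - i) * w x)) := by gcongr
    _ = _ := by ring

theorem DerivsDominated.prod {ι : Type*} (s : Finset ι) {f : ι → ℝ → ℂ} {w : ι → ℝ → ℝ}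
    (h : ∀ i, DerivsDominated (f i) (w i)) :
    DerivsDominated (fun x => ∏ i ∈ s, f i x) (fun x => ∏ i ∈ s, w i x) := by
  classical
  induction s using Finset.induction_on with
  | empty =>
    refine ⟨by simpa using contDiff_const, fun n => ⟨1, fun x => ?_⟩⟩
    simp only [Finset.prod_empty, iteratedDeriv_const]
    split_ifs <;> simp
  | insert i s hi ih =>
    simp only [Finset.prod_insert hi]
    exact (h i).mul ih

theorem derivsDominated_sub_exp (c : ℂ) :
    DerivsDominated (fun ξ : ℝ => c - Complex.exp (-(Complex.I * ξ))) (fun _ => 1) := by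
  have hd : ∀ ξ : ℝ, HasDerivAt (fun ξ : ℝ => Complex.exp (-(Complex.I * ξ)))
      (-Complex.I * Complex.exp (-(Complex.I * ξ))) ξ := fun ξ => by
    have h1 : HasDerivAt (fun ξ : ℝ => -(Complex.I * (ξ : ℂ))) (-(Complex.I * 1)) ξ :=
      ((HasDerivAt.ofReal_comp (hasDerivAt_id ξ)).const_mul Complex.I).fun_neg
    convert! h1.cexp using 1
    ring
  have key : ∀ (n : ℕ) (a b : ℂ), ∃ C : ℝ, ∀ x : ℝ,
      ‖iteratedDeriv n (fun ξ : ℝ => a + b * Complex.exp (-(Complex.I * ξ))) x‖ ≤ C * 1 := by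
    intro n
    induction n with
    | zero =>
      intro a b
      refine ⟨‖a‖ + ‖b‖, fun x => ?_⟩
      rw [iteratedDeriv_zero]
      refine (norm_add_le _ _).trans ?_
      rw [norm_mul, Complex.norm_exp]
      simp
    | succ n ih =>
      intro a b
      obtain ⟨C, hC⟩ := ih 0 (b * -Complex.I)
      refine ⟨C, fun x => ?_⟩
      rw [iteratedDeriv_succ']
      convert hC x using 3
      ext ξ
      rw [(((hd ξ).const_mul b).const_add a).deriv]
      ring
  refine ⟨?_, fun n => ?_⟩
  · have : ContDiff ℝ (⊤ : ℕ∞) (fun ξ : ℝ => (ξ : ℂ)) := Complex.ofRealCLM.contDiff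
    exact contDiff_const.sub ((contDiff_const.mul this).neg.cexp)
  · obtain ⟨C, hC⟩ := key n c (-1)
    refine ⟨C, fun x => ?_⟩
    convert hC x using 3
    ext ξ
    ring

theorem I_mul_sub_ofReal_ne_zero {l : ℝ} (hl : l ≠ 0) (ξ : ℝ) : Complex.I * ξ - (l : ℂ) ≠ 0 := by
  intro h
  have := congrArg Complex.re h
  simp at this
  exact hl this

theorem exists_norm_inv_I_mul_sub_le {l : ℝ} (hl : l ≠ 0) :
    ∃ C : ℝ, ∀ ξ : ℝ, ‖(Complex.I * ξ - (l : ℂ))⁻¹‖ ≤ C * (1 + |ξ|)⁻¹ := by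
  refine ⟨1 + |l|⁻¹, fun ξ => ?_⟩
  have hl' : 0 < |l| := abs_pos.2 hl
  have h1 : |l| ≤ ‖Complex.I * ξ - (l : ℂ)‖ := by
    simpa using Complex.abs_re_le_norm (Complex.I * ξ - (l : ℂ))
  have h2 : |ξ| ≤ ‖Complex.I * ξ - (l : ℂ)‖ := by
    simpa using Complex.abs_im_le_norm (Complex.I * ξ - (l : ℂ))
  have h3 : 0 < ‖Complex.I * ξ - (l : ℂ)‖ := hl'.trans_le h1
  rw [norm_inv, ← div_eq_mul_inv, inv_eq_one_div, div_le_div_iff₀ h3 (by positivity)]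
  have h4 : 1 ≤ |l|⁻¹ * ‖Complex.I * ξ - (l : ℂ)‖ := by
    rw [inv_mul_eq_div, one_le_div hl']
    exact h1
  linarith

theorem derivsDominated_inv {l : ℝ} (hl : l ≠ 0) :
    DerivsDominated (fun ξ : ℝ => (Complex.I * ξ - (l : ℂ))⁻¹) (fun ξ => (1 + |ξ|)⁻¹) := by
  have hd : ∀ ξ : ℝ, HasDerivAt (fun ξ : ℝ => (Complex.I * ξ - (l : ℂ))⁻¹)
      (-Complex.I * ((Complex.I * ξ - (l : ℂ))⁻¹) ^ 2) ξ := fun ξ => by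
    have h1 : HasDerivAt (fun ξ : ℝ => Complex.I * (ξ : ℂ) - (l : ℂ)) (Complex.I * 1) ξ :=
      ((HasDerivAt.ofReal_comp (hasDerivAt_id ξ)).const_mul Complex.I).sub_const _
    convert! h1.inv (I_mul_sub_ofReal_ne_zero hl ξ) using 1
    field_simp
  obtain ⟨D, hD⟩ := exists_norm_inv_I_mul_sub_le hl
  have hDnn : 0 ≤ D := by
    have := (norm_nonneg _).trans (hD 0)
    simpa using this
  -- Differentiation raises the power of the inverse, so the induction runs over all powers at once;
  -- the surplus factors are bounded.
  have key : ∀ (n m : ℕ) (c : ℂ), ∃ C : ℝ, ∀ x : ℝ,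
      ‖iteratedDeriv n (fun ξ : ℝ => c * ((Complex.I * ξ - (l : ℂ))⁻¹) ^ (m + 1)) x‖ ≤
        C * (1 + |x|)⁻¹ := by
    intro n
    induction n with
    | zero =>
      intro m c
      refine ⟨‖c‖ * D ^ (m + 1), fun x => ?_⟩
      rw [iteratedDeriv_zero, norm_mul, norm_pow, mul_assoc]
      gcongr
      refine (pow_le_pow_left₀ (norm_nonneg _) (hD x) _).trans ?_
      rw [mul_pow]
      gcongr
      exact pow_le_of_le_one (by positivity)
        (inv_le_one_of_one_le₀ (by linarith [abs_nonneg x])) (by simp)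
    | succ n ih =>
      intro m c
      obtain ⟨C, hC⟩ := ih (m + 1) (c * ((m + 1 : ℕ) * -Complex.I))
      refine ⟨C, fun x => ?_⟩
      rw [iteratedDeriv_succ']
      convert hC x using 3
      ext ξ
      rw [(((hd ξ).fun_pow (m + 1)).const_mul c).deriv]
      simp only [Nat.add_sub_cancel]
      ring
  refine ⟨?_, fun n => ?_⟩
  · have : ContDiff ℝ (⊤ : ℕ∞) (fun ξ : ℝ => (ξ : ℂ)) := Complex.ofRealCLM.contDiff
    exact ((contDiff_const.mul this).sub contDiff_const).inv fun ξ => I_mul_sub_ofReal_ne_zero hl ξ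
  · obtain ⟨C, hC⟩ := key n 0 1
    refine ⟨C, fun x => ?_⟩
    convert hC x using 3
    ext ξ
    simp

/-- Each frequency contributes a bounded numerator and a decay `(1 + |ξ|)⁻¹`, so two frequencies
already give an integrable weight. A zero frequency would put the default value of the quotient at
`ξ = 0` and could break smoothness there. -/
theorem derivsDominated_tbSplineHat {ι : Type*} [Fintype ι] {Λ : ι → ℝ} (hΛ : ∀ j, Λ j ≠ 0)
    (hι : 2 ≤ Fintype.card ι) :
    DerivsDominated (tbSplineHat Λ) (fun ξ => (1 + ξ ^ 2)⁻¹) := by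
  have h := DerivsDominated.prod Finset.univ fun j =>
    (derivsDominated_sub_exp (Complex.exp (-(Λ j : ℂ)))).mul (derivsDominated_inv (hΛ j))
  refine ⟨?_, fun n => ?_⟩
  · convert h.1 using 1
    ext ξ
    simp only [tbSplineHat, div_eq_mul_inv, Finset.prod_mul_distrib, Finset.prod_inv_distrib]
  · obtain ⟨C, hC⟩ := h.2 n
    refine ⟨|C|, fun x => ?_⟩
    have h1 : tbSplineHat Λ = fun ξ : ℝ => ∏ j, (Complex.exp (-(Λ j : ℂ)) -
        Complex.exp (-(Complex.I * ξ))) * (Complex.I * ξ - (Λ j : ℂ))⁻¹ := by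
      ext ξ
      simp only [tbSplineHat, div_eq_mul_inv, Finset.prod_mul_distrib, Finset.prod_inv_distrib]
    rw [h1]
    refine (hC x).trans ?_
    simp only [one_mul, Finset.prod_const, Finset.card_univ]
    have h0 : (1 + |x|)⁻¹ ≤ 1 := inv_le_one_of_one_le₀ (by linarith [abs_nonneg x])
    have h2 : ((1 + |x|)⁻¹) ^ Fintype.card ι ≤ (1 + x ^ 2)⁻¹ := by
      refine (pow_le_pow_of_le_one (by positivity) h0 hι).trans ?_
      rw [inv_pow]
      refine inv_anti₀ (by positivity) ?_
      rw [← sq_abs x]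
      nlinarith [abs_nonneg x]
    exact mul_le_mul (le_abs_self C) h2 (by positivity) (abs_nonneg C)

/-- Two derivatives are integrable, and each multiplies the Fourier transform by `2πix`. -/
theorem DerivsDominated.isBigO_fourier {f : ℝ → ℂ}
    (hf : DerivsDominated f (fun ξ => (1 + ξ ^ 2)⁻¹)) :
    (𝓕 f) =O[cocompact ℝ] fun x => |x| ^ (-2 : ℝ) := by
  have hint : ∀ n, Integrable (iteratedDeriv n f) := fun n => by
    obtain ⟨C, hC⟩ := hf.2 n
    exact (integrable_inv_one_add_sq.const_mul C).mono'
      (hf.1.continuous_iteratedDeriv n (by exact_mod_cast le_top)).aestronglyMeasurable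
      (Eventually.of_forall hC)
  have hdiff : ∀ n, Differentiable ℝ (iteratedDeriv n f) := fun n =>
    hf.1.differentiable_iteratedDeriv n (by exact_mod_cast WithTop.coe_lt_top n)
  have hstep : ∀ n, 𝓕 (iteratedDeriv (n + 1) f) =
      fun x : ℝ => (2 * Real.pi * Complex.I * x) • 𝓕 (iteratedDeriv n f) x := fun n => by
    rw [iteratedDeriv_succ]
    exact Real.fourier_deriv (hint n) (hdiff n) (by rw [← iteratedDeriv_succ]; exact hint _)
  have h2 : ∀ x : ℝ, 𝓕 (iteratedDeriv 2 f) x =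
      (2 * Real.pi * Complex.I * x) ^ 2 * 𝓕 f x := fun x => by
    rw [hstep 1, hstep 0, iteratedDeriv_zero]
    simp only [smul_eq_mul]
    ring
  refine IsBigO.of_bound (∫ v, ‖iteratedDeriv 2 f v‖) ?_
  have : ∀ᶠ x : ℝ in cocompact ℝ, x ≠ 0 := by
    have := (isCompact_singleton (x := (0 : ℝ))).compl_mem_cocompact
    filter_upwards [this] with x hx using by simpa using hx
  filter_upwards [this] with x hx
  have hb : ‖𝓕 (iteratedDeriv 2 f) x‖ ≤ ∫ v, ‖iteratedDeriv 2 f v‖ :=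
    VectorFourier.norm_fourierIntegral_le_integral_norm _ _ _ _ _
  rw [h2 x, norm_mul, norm_pow] at hb
  have hx' : 0 < |x| := abs_pos.2 hx
  have hn : ‖(2 * Real.pi * Complex.I * x : ℂ)‖ = 2 * Real.pi * |x| := by
    simp [abs_of_pos Real.pi_pos]
  rw [hn] at hb
  rw [Real.rpow_neg (abs_nonneg x), Real.rpow_two, Real.norm_of_nonneg (by positivity),
    ← div_eq_mul_inv, le_div_iff₀ (by positivity)]
  have hpi : 1 ≤ (2 * Real.pi) ^ 2 := by nlinarith [Real.pi_gt_three]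
  calc ‖𝓕 f x‖ * |x| ^ 2 ≤ (2 * Real.pi) ^ 2 * (‖𝓕 f x‖ * |x| ^ 2) :=
        le_mul_of_one_le_left (by positivity) hpi
    _ = (2 * Real.pi * |x|) ^ 2 * ‖𝓕 f x‖ := by ring
    _ ≤ _ := hb

theorem inv_one_add_sq_isBigO :
    (fun x : ℝ => (1 + x ^ 2)⁻¹) =O[cocompact ℝ] fun x => |x| ^ (-2 : ℝ) := by
  refine IsBigO.of_bound 1 ?_
  have : ∀ᶠ x : ℝ in cocompact ℝ, x ≠ 0 := by
    have := (isCompact_singleton (x := (0 : ℝ))).compl_mem_cocompact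
    filter_upwards [this] with x hx using by simpa using hx
  filter_upwards [this] with x hx
  have hx' : 0 < |x| := abs_pos.2 hx
  rw [Real.rpow_neg (abs_nonneg x), Real.rpow_two, Real.norm_of_nonneg (by positivity),
    Real.norm_of_nonneg (by positivity), one_mul, sq_abs]
  exact inv_anti₀ (by positivity) (by linarith)

/-- Poisson's summation formula for period `2π`. -/
theorem DerivsDominated.tsum_invFourier {f : ℝ → ℂ}
    (hf : DerivsDominated f (fun ξ => (1 + ξ ^ 2)⁻¹)) (ξ : ℝ) :
    ∑' j : ℤ, invFourier f (j : ℝ) * Complex.exp (-(Complex.I * ξ * j)) =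
      ∑' m : ℤ, f (ξ + 2 * Real.pi * m) := by
  have hpi := Real.pi_pos
  -- Rescaling to period `1`; then `𝓕 g y` is `invFourier f (-y)`, which is why the sum is later
  -- reindexed by `m ↦ -m`.
  set g : ℝ → ℂ := fun x => f (2 * Real.pi * x) with hg
  have hgF : ∀ y : ℝ, 𝓕 g y = (1 / (2 * (Real.pi : ℂ))) *
      ∫ ξ : ℝ, Complex.exp (Complex.I * ξ * (-y)) * f ξ := fun y => by
    rw [Real.fourier_eq', hg]
    have := Measure.integral_comp_mul_left
      (fun ξ : ℝ => Complex.exp (Complex.I * ξ * (-y)) * f ξ) (2 * Real.pi)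
    rw [abs_of_pos (by positivity)] at this
    convert! this using 1
    · congr 1
      ext v
      simp only [smul_eq_mul]
      congr 2
      simp
      ring
    · rw [Complex.real_smul]
      push_cast
      rw [one_div]
  have hcont : Continuous g := hf.1.continuous.comp (continuous_const.mul continuous_id)
  obtain ⟨C, hC⟩ := hf.2 0
  have hbig : g =O[cocompact ℝ] fun x => |x| ^ (-2 : ℝ) := by
    refine IsBigO.trans ?_ inv_one_add_sq_isBigO
    refine IsBigO.of_bound |C| (Eventually.of_forall fun x => ?_)
    have h1 := hC (2 * Real.pi * x)
    rw [iteratedDeriv_zero] at h1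
    refine h1.trans ?_
    rw [Real.norm_of_nonneg (by positivity)]
    refine mul_le_mul (le_abs_self C) (inv_anti₀ (by positivity) ?_) (by positivity) (abs_nonneg C)
    have : 1 ≤ (2 * Real.pi) ^ 2 := by nlinarith [Real.pi_gt_three]
    rw [mul_pow]
    nlinarith [sq_nonneg x]
  have hinv : ∀ y : ℝ, 𝓕 g y = (1 / (2 * Real.pi) : ℂ) * 𝓕 f (y / (2 * Real.pi)) := fun y => by
    rw [hgF, Real.fourier_eq']
    congr 2
    ext v
    simp only [smul_eq_mul]
    congr 2
    simp
    field_simp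
  have hgFbig : (𝓕 g) =O[cocompact ℝ] fun x => |x| ^ (-2 : ℝ) := by
    have ht : Tendsto (fun y : ℝ => y / (2 * Real.pi)) (cocompact ℝ) (cocompact ℝ) := by
      have := (Homeomorph.mulRight₀ ((2 * Real.pi)⁻¹)
        (by positivity)).isClosedEmbedding.tendsto_cocompact
      simpa [div_eq_mul_inv] using this
    have h1 := (hf.isBigO_fourier.comp_tendsto ht).const_mul_left (1 / (2 * Real.pi) : ℂ)
    have h2 : (𝓕 g) = fun y => (1 / (2 * Real.pi) : ℂ) *
        ((𝓕 f) ∘ fun y => y / (2 * Real.pi)) y := by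
      ext y; rw [hinv]; rfl
    rw [h2]
    refine h1.trans (IsBigO.of_bound ((2 * Real.pi) ^ 2) (Eventually.of_forall fun x => ?_))
    simp only [Function.comp]
    rw [abs_div, Real.div_rpow (abs_nonneg _) (abs_nonneg _),
      abs_of_pos (by positivity : 0 < 2 * Real.pi),
      Real.rpow_neg (by positivity : 0 ≤ 2 * Real.pi), Real.rpow_two, div_inv_eq_mul, norm_mul,
      Real.norm_of_nonneg (by positivity : 0 ≤ (2 * Real.pi) ^ 2), mul_comm]
  have hP := Real.tsum_eq_tsum_fourier_of_rpow_decay hcont one_lt_two hbig hgFbig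
    (ξ / (2 * Real.pi))
  have hL : ∀ m : ℤ, g (ξ / (2 * Real.pi) + m) = f (ξ + 2 * Real.pi * m) := fun m => by
    simp only [hg]
    congr 1
    field_simp
  simp only [hL] at hP
  rw [hP, ← (Equiv.neg ℤ).tsum_eq]
  congr 1
  ext m
  rw [hgF, invFourier]
  congr 1
  · simp
  · rw [fourier_coe_apply]
    congr 1
    simp
    field_simp

theorem tbSymbol_eq_tsum {ι : Type*} [Fintype ι] {Λ : ι → ℝ} (hΛ : ∀ j, Λ j ≠ 0)
    (hι : 2 ≤ Fintype.card ι) (ξ : ℝ) :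
    tbSymbol Λ ξ = ∑' m : ℤ, tbSplineHat Λ (ξ + 2 * Real.pi * m) :=
  (derivsDominated_tbSplineHat hΛ hι).tsum_invFourier ξ

/-! ### Periodization and the uniform bound for the radial splines -/

theorem lintegral_eq_setLIntegral_tsum_translates {T : ℝ} (hT : 0 < T) {f : ℝ → ENNReal}
    (hf : Measurable f) :
    ∫⁻ x, f x = ∫⁻ x in Set.Ioc 0 (0 + T), ∑' m : ℤ, f (x + T * m) := by
  have hmeas : ∀ m : ℤ, Measurable fun x => f (x + T * m) := fun m =>
    hf.comp (measurable_id.add_const _)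
  rw [(isAddFundamentalDomain_Ioc hT 0 volume).lintegral_eq_tsum'' f,
    lintegral_tsum fun m => (hmeas m).aemeasurable]
  have hb : Function.Bijective (Set.codRestrict (fun n : ℤ => n • T) (AddSubgroup.zmultiples T)
      fun n => AddSubgroup.zsmul_mem_zmultiples T n :
      ℤ → AddSubgroup.zmultiples T) :=
    (Equiv.ofInjective (fun n : ℤ => n • T) (zsmul_left_strictMono hT).injective).bijective
  refine ((Equiv.ofBijective _ hb).tsum_eq _).symm.trans ?_
  congr 1
  ext m
  refine lintegral_congr fun x => ?_
  congr 1
  change (m • T) + x = _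
  rw [zsmul_eq_mul]
  ring

/-- The denominator is `T`-periodic, so unfolding the integral onto one period turns the integrand
into a sum divided by itself, which is at most `1` in `ENNReal` even when the sum is `0` or `∞`. -/
theorem lintegral_div_tsum_translates_le {T : ℝ} (hT : 0 < T) {W : ℝ → ENNReal}
    (hW : Measurable W) :
    ∫⁻ x, W x / ∑' m : ℤ, W (x + T * m) ≤ ENNReal.ofReal T := by
  have hS : Measurable fun x => ∑' m : ℤ, W (x + T * m) :=
    Measurable.tsum fun m => hW.comp (measurable_id.add_const _)
  have hq : Measurable fun x => W x / ∑' m : ℤ, W (x + T * m) := hW.div hS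
  rw [lintegral_eq_setLIntegral_tsum_translates hT hq]
  have hper : ∀ (x : ℝ) (k : ℤ), ∑' m : ℤ, W (x + T * k + T * m) = ∑' m : ℤ, W (x + T * m) := by
    intro x k
    rw [← (Equiv.addLeft k).tsum_eq fun m : ℤ => W (x + T * m)]
    congr 1
    ext m
    congr 1
    simp only [Equiv.coe_addLeft]
    push_cast
    ring
  calc _ ≤ ∫⁻ x in Set.Ioc 0 (0 + T), 1 := by
        refine lintegral_mono fun x => ?_
        simp only [hper, div_eq_mul_inv]
        rw [ENNReal.tsum_mul_right, ← div_eq_mul_inv]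
        exact ENNReal.div_self_le_one
    _ = ENNReal.ofReal T := by simp

theorem exp_neg_I_mul_add_two_pi (ξ : ℝ) (m : ℤ) :
    Complex.exp (-(Complex.I * ((ξ + 2 * Real.pi * m : ℝ) : ℂ))) =
      Complex.exp (-(Complex.I * ξ)) := by
  rw [Complex.exp_eq_exp_iff_exists_int]
  refine ⟨-m, ?_⟩
  push_cast
  ring

/-- All terms nearly share the phase `c`, so the sum cannot cancel: `‖Q i‖ ≤ (4/3) M i` and `‖∑ Q‖ ≥
(2/3) ∑ M`, whose ratio gives the `2`. -/
theorem norm_div_tsum_le {Q : ℤ → ℂ} {M : ℤ → ℝ} {c : ℂ} (hc : ‖c‖ = 1) (hM : ∀ m, 0 < M m)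
    (hQ : ∀ m, ‖Q m - c * M m‖ ≤ M m / 3) (i : ℤ) :
    ‖Q i / ∑' m, Q m‖ₑ ≤ 2 * (ENNReal.ofReal (M i) / ∑' m, ENNReal.ofReal (M m)) := by
  -- Without summability the `tsum` is `0` by default, and division by it gives `0`.
  by_cases hs : Summable Q
  swap
  · simp [tsum_eq_zero_of_not_summable hs]
  have hcM : ∀ m, ‖c * (M m : ℂ)‖ = M m := fun m => by
    rw [norm_mul, hc, one_mul, Complex.norm_real, Real.norm_of_nonneg (hM m).le]
  have hup : ∀ m, ‖Q m‖ ≤ 4 / 3 * M m := fun m => by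
    have := norm_le_norm_add_norm_sub' (Q m) (c * M m)
    rw [hcM] at this
    linarith [hQ m]
  have hlow : ∀ m, M m ≤ 3 / 2 * ‖Q m‖ := fun m => by
    have := norm_le_norm_add_norm_sub' (c * (M m : ℂ)) (Q m)
    rw [hcM, norm_sub_rev] at this
    linarith [hQ m]
  have hsM : Summable M :=
    Summable.of_nonneg_of_le (fun m => (hM m).le) hlow (hs.norm.mul_left _)
  have hpos : 0 < ∑' m, M m := hsM.tsum_pos (fun m => (hM m).le) i (hM i)
  have hsum : 2 / 3 * ∑' m, M m ≤ ‖∑' m, Q m‖ := by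
    have hsc : Summable fun m => c * (M m : ℂ) := (Complex.summable_ofReal.2 hsM).mul_left c
    have h1 : ‖∑' m, Q m - ∑' m, c * (M m : ℂ)‖ ≤ ∑' m, M m / 3 := by
      rw [← hs.tsum_sub hsc]
      exact tsum_of_norm_bounded (hsM.div_const 3).hasSum hQ
    have h2 : ‖∑' m, c * (M m : ℂ)‖ = ∑' m, M m := by
      rw [tsum_mul_left, norm_mul, hc, one_mul, ← Complex.ofReal_tsum, Complex.norm_real,
        Real.norm_of_nonneg hpos.le]
    rw [tsum_div_const] at h1
    have := norm_le_norm_add_norm_sub' (∑' m, c * (M m : ℂ)) (∑' m, Q m)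
    rw [h2, norm_sub_rev] at this
    linarith
  rw [← ENNReal.ofReal_tsum_of_nonneg (fun m => (hM m).le) hsM, ← ENNReal.ofReal_div_of_pos hpos,
    show (2 : ENNReal) = ENNReal.ofReal 2 by simp, ← ENNReal.ofReal_mul zero_le_two,
    ← ofReal_norm]
  refine ENNReal.ofReal_le_ofReal ?_
  rw [norm_div, ← mul_div_assoc, div_le_div_iff₀ (by linarith) hpos]
  nlinarith [hup i, hM i, norm_nonneg (Q i)]

/-- If the reciprocal of `∏ⱼ (iξ - λⱼ)` is close to a positive function up to a constant phase,
then the Shannon–Walter spline is bounded by `2`. -/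
theorem norm_shannonWalter_le {ι : Type*} [Fintype ι] {Λ : ι → ℝ} (hΛ : ∀ j, Λ j ≠ 0)
    (hι : 2 ≤ Fintype.card ι) {M : ℝ → ℝ} (hMm : Measurable M) (hM : ∀ ξ, 0 < M ξ) {c : ℂ}
    (hc : ‖c‖ = 1)
    (hQ : ∀ ξ : ℝ, ‖(∏ j, (Complex.I * ξ - (Λ j : ℂ)))⁻¹ - c * M ξ‖ ≤ M ξ / 3) (t : ℝ) :
    ‖shannonWalter Λ t‖ ≤ 2 := by
  set Q : ℝ → ℂ := fun ξ => (∏ j, (Complex.I * ξ - (Λ j : ℂ)))⁻¹ with hQdef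
  set N : ℝ → ℂ := fun ξ =>
    ∏ j, (Complex.exp (-(Λ j : ℂ)) - Complex.exp (-(Complex.I * ξ))) with hN
  have hhat : ∀ ξ, tbSplineHat Λ ξ = N ξ * Q ξ := fun ξ => div_eq_mul_inv _ _
  have hNper : ∀ ξ (m : ℤ), N (ξ + 2 * Real.pi * m) = N ξ := fun ξ m => by
    simp only [hN, exp_neg_I_mul_add_two_pi]
  -- The periodic numerator `N` leaves the Poisson sum and will cancel in the quotient.
  have hsym : ∀ ξ, tbSymbol Λ ξ = N ξ * ∑' m : ℤ, Q (ξ + 2 * Real.pi * m) := fun ξ => by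
    rw [tbSymbol_eq_tsum hΛ hι, ← tsum_mul_left]
    simp only [hhat, hNper]
  have hpi : 0 < 2 * Real.pi := by positivity
  have hpt : ∀ ξ : ℝ, ‖tbSplineHat Λ ξ / tbSymbol Λ ξ‖ₑ ≤
      2 * (ENNReal.ofReal (M ξ) / ∑' m : ℤ, ENNReal.ofReal (M (ξ + 2 * Real.pi * m))) := by
    intro ξ
    have h := norm_div_tsum_le (Q := fun m => Q (ξ + 2 * Real.pi * m))
      (M := fun m => M (ξ + 2 * Real.pi * m)) hc (fun m => hM _) (fun m => hQ _) 0
    simp only [Int.cast_zero, mul_zero, add_zero] at h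
    rw [hhat, hsym]
    by_cases h0 : N ξ = 0
    · simp [h0]
    · rwa [mul_div_mul_left _ _ h0]
  have hint : ‖∫ ξ : ℝ, Complex.exp (Complex.I * ξ * t) *
      (tbSplineHat Λ ξ / tbSymbol Λ ξ)‖ₑ ≤ ENNReal.ofReal (2 * (2 * Real.pi)) := by
    refine (enorm_integral_le_lintegral_enorm _).trans ?_
    calc _ ≤ ∫⁻ ξ : ℝ, 2 * (ENNReal.ofReal (M ξ) /
          ∑' m : ℤ, ENNReal.ofReal (M (ξ + 2 * Real.pi * m))) := by
          refine lintegral_mono fun ξ => ?_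
          refine le_trans (le_of_eq ?_) (hpt ξ)
          rw [enorm_mul, ← ofReal_norm (Complex.exp _), Complex.norm_exp]
          simp
      _ ≤ 2 * ENNReal.ofReal (2 * Real.pi) := by
          rw [lintegral_const_mul' _ _ (by simp)]
          gcongr
          exact lintegral_div_tsum_translates_le hpi hMm.ennreal_ofReal
      _ = _ := by
          rw [ENNReal.ofReal_mul zero_le_two]
          simp
  rw [← ofReal_norm, ENNReal.ofReal_le_ofReal_iff (by positivity)] at hint
  rw [shannonWalter, invFourier, norm_mul]
  have : ‖(1 / (2 * (Real.pi : ℂ)))‖ = 1 / (2 * Real.pi) := by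
    simp [abs_of_pos Real.pi_pos]
  rw [this, one_div, inv_mul_le_iff₀ hpi]
  linarith

/-- Quadratic factors `-(x - iy)` with `|y| ≤ δ x` have a product with nearly constant phase. -/
theorem norm_inv_prod_sub_le {ι : Type*} [Fintype ι] {x y : ι → ℝ} {δ : ℝ} (hx : ∀ j, 0 < x j)
    (hy : ∀ j, |y j| ≤ δ * x j) (hδ : Fintype.card ι * δ ≤ 1 / 4) :
    ‖(∏ j, (-((x j : ℂ) - Complex.I * y j)))⁻¹ -
        (-1) ^ Fintype.card ι * ((∏ j, x j / (x j ^ 2 + y j ^ 2) : ℝ) : ℂ)‖ ≤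
      (∏ j, x j / (x j ^ 2 + y j ^ 2)) / 3 := by
  have hD : ∀ j, 0 < x j ^ 2 + y j ^ 2 := fun j => by have := hx j; positivity
  -- Each inverse factor is `-1` times a positive number times `1 + iy/x`, and the deviation of `∏
  -- (1 + iy/x)` from `1` is at most `exp (∑ |y/x|) - 1 ≤ e^{1/4} - 1 ≤ 1/3`.
  have hfac : ∀ j, (-((x j : ℂ) - Complex.I * y j))⁻¹ =
      (-1) * ((x j / (x j ^ 2 + y j ^ 2) : ℝ) : ℂ) *
        (1 + Complex.I * (y j / x j : ℝ)) := fun j => by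
    have h1 : ((x j : ℂ) - Complex.I * y j) * ((x j : ℂ) + Complex.I * y j) =
        ((x j ^ 2 + y j ^ 2 : ℝ) : ℂ) := by
      push_cast
      linear_combination (-(y j : ℂ) ^ 2) * Complex.I_sq
    have h2 : ((x j ^ 2 + y j ^ 2 : ℝ) : ℂ) ≠ 0 := by exact_mod_cast (hD j).ne'
    have h3 : (x j : ℂ) - Complex.I * y j ≠ 0 := fun h => by
      rw [h, zero_mul] at h1
      exact h2 h1.symm
    have h4 : (x j : ℂ) ≠ 0 := by exact_mod_cast (hx j).ne'
    rw [Complex.ofReal_div, Complex.ofReal_div, ← h1]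
    have h5 : (x j : ℂ) + Complex.I * y j ≠ 0 := fun h => by
      rw [h, mul_zero] at h1
      exact h2 h1.symm
    rw [inv_neg]
    field_simp
  rw [← Finset.prod_inv_distrib]
  simp only [hfac]
  rw [Finset.prod_mul_distrib, Finset.prod_mul_distrib, Finset.prod_const, Finset.card_univ,
    ← Complex.ofReal_prod, ← mul_sub_one, norm_mul, norm_mul, Complex.norm_real]
  have hP : 0 ≤ ∏ j, x j / (x j ^ 2 + y j ^ 2) :=
    Finset.prod_nonneg fun j _ => div_nonneg (hx j).le (hD j).le
  rw [Real.norm_of_nonneg hP, norm_pow, norm_neg, norm_one, one_pow, one_mul, div_eq_mul_inv]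
  refine mul_le_mul_of_nonneg_left ?_ hP
  refine (Finset.norm_prod_one_add_sub_one_le _ _).trans ?_
  have hsum : ∑ j, ‖Complex.I * ((y j / x j : ℝ) : ℂ)‖ ≤ 1 / 4 := by
    refine le_trans (Finset.sum_le_card_nsmul _ _ δ fun j _ => ?_) ?_
    · rw [norm_mul, Complex.norm_I, one_mul, Complex.norm_real, Real.norm_eq_abs, abs_div,
        abs_of_pos (hx j), div_le_iff₀ (hx j)]
      exact hy j
    · simpa using hδ
  have h4 : Real.exp (1 / 4) ≤ 4 / 3 := by
    have h := Real.one_sub_le_exp_neg (1 / 4)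
    rw [Real.exp_neg] at h
    rw [← inv_inv (Real.exp (1 / 4))]
    refine (inv_anti₀ (by norm_num) h).trans (by norm_num)
  linarith [Real.exp_le_exp.2 hsum]

theorem exists_forall_norm_radialShannon_le (n p : ℕ) (hp : 1 ≤ p) :
    ∃ K : ℕ, ∀ k, K ≤ k → ∀ r, ‖radialShannon n p k r‖ ≤ 2 := by
  -- The threshold makes `L = k - 2p`, a lower bound for all `A j` and `B j`, exceed `2p(n + 4p)`.
  -- This is what `p δ ≤ 1/4` requires for `δ = (n + 4p) / (2L)`, and it keeps every frequency away
  -- from `0`.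
  refine ⟨2 * p + 2 * p * (n + 4 * p) + 1, fun k hk r => ?_⟩
  set L : ℝ := (k : ℝ) - 2 * p with hL
  have hkR : (2 * p + 2 * p * (n + 4 * p) + 1 : ℝ) ≤ k := by exact_mod_cast hk
  have hL0 : 2 * p * (n + 4 * p) + 1 ≤ L := by rw [hL]; linarith
  have hLpos : 0 < L := by
    have : (0 : ℝ) ≤ 2 * p * (n + 4 * p) := by positivity
    linarith
  have hj : ∀ j : Fin p, ((j : ℕ) : ℝ) + 1 ≤ p := fun j => by exact_mod_cast j.2
  have hj0 : ∀ j : Fin p, (0 : ℝ) ≤ ((j : ℕ) : ℝ) := fun j => Nat.cast_nonneg _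
  have hn0 : (0 : ℝ) ≤ n := Nat.cast_nonneg _
  have hp1 : (1 : ℝ) ≤ p := by exact_mod_cast hp
  set A : Fin p → ℝ := fun j => (k : ℝ) + 2 * ((j : ℕ) : ℝ) with hA
  set B : Fin p → ℝ := fun j => (n : ℝ) + k - 2 - 2 * ((j : ℕ) : ℝ) with hB
  have hAL : ∀ j, L ≤ A j := fun j => by simp only [hA, hL]; linarith [hj0 j]
  have hBL : ∀ j, L ≤ B j := fun j => by simp only [hB, hL]; linarith [hj j]
  have hAB : ∀ j, L ^ 2 ≤ A j * B j := fun j => by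
    rw [sq]
    exact mul_le_mul (hAL j) (hBL j) hLpos.le (hLpos.le.trans (hAL j))
  have hBA : ∀ j, |B j - A j| ≤ n + 4 * p := fun j => by
    simp only [hA, hB]
    rw [abs_le]
    constructor <;> linarith [hj j, hj0 j]
  have hΛ : ∀ j, polysplineFreq n p k j ≠ 0 := by
    rintro (j | j)
    · exact (hLpos.trans_le (hAL j)).ne'
    · have := hLpos.trans_le (hBL j)
      simp only [hB] at this
      simp only [polysplineFreq, Sum.elim_inr]
      intro h
      linarith
  have hx : ∀ (ξ : ℝ) (j : Fin p), 0 < ξ ^ 2 + A j * B j := fun ξ j => by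
    have := hAB j
    have : 0 < L ^ 2 := by positivity
    nlinarith [sq_nonneg ξ]
  have hcard : 2 ≤ Fintype.card (Fin p ⊕ Fin p) := by simp; omega
  refine norm_shannonWalter_le hΛ hcard
    (M := fun ξ => ∏ j : Fin p, (ξ ^ 2 + A j * B j) /
      ((ξ ^ 2 + A j * B j) ^ 2 + (ξ * (B j - A j)) ^ 2))
    (c := (-1) ^ p) ?_ ?_ (by simp) ?_ _
  · fun_prop
  · intro ξ
    refine Finset.prod_pos fun j _ => ?_
    have := hx ξ j
    positivity
  · intro ξ
    -- The pairing is `(iξ - A)(iξ + B) = -((ξ² + AB) - iξ(B - A))`.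
    have h := norm_inv_prod_sub_le (x := fun j : Fin p => ξ ^ 2 + A j * B j)
      (y := fun j => ξ * (B j - A j)) (δ := (n + 4 * p) / (2 * L)) (hx ξ) ?_ ?_
    · convert h using 3
      · rw [Fintype.prod_sum_type, ← Finset.prod_mul_distrib]
        congr 1
        refine Finset.prod_congr rfl fun j _ => ?_
        simp only [polysplineFreq, Sum.elim_inl, Sum.elim_inr, hA, hB]
        push_cast
        linear_combination (ξ : ℂ) ^ 2 * Complex.I_sq
      · simp
    · intro j
      rw [abs_mul, div_mul_eq_mul_div, le_div_iff₀ (by positivity)]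
      -- From `(|ξ| - L)² ≥ 0` and `L² ≤ A j * B j`.
      have h1 : 2 * L * |ξ| ≤ ξ ^ 2 + A j * B j := by
        have := hAB j
        rw [← sq_abs ξ]
        nlinarith [sq_nonneg (|ξ| - L)]
      calc |ξ| * |B j - A j| * (2 * L) = |B j - A j| * (2 * L * |ξ|) := by ring
        _ ≤ _ := mul_le_mul (hBA j) h1 (by positivity) (by positivity)
    · rw [Fintype.card_fin, ← mul_div_assoc, div_le_iff₀ (by positivity)]
      linarith

end RadialPart

/-! ### Rotation invariance and the reproducing kernel of the spherical harmonics -/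

/-- The action of a linear isometry on the unit sphere. -/
noncomputable def sphereMap {n : ℕ} (ρ : EuclideanSpace ℝ (Fin n) ≃ₗᵢ[ℝ] EuclideanSpace ℝ (Fin n))
    (θ : UnitSphere n) : UnitSphere n :=
  ⟨ρ θ.1, by simp⟩

theorem continuous_sphereMap {n : ℕ}
    (ρ : EuclideanSpace ℝ (Fin n) ≃ₗᵢ[ℝ] EuclideanSpace ℝ (Fin n)) : Continuous (sphereMap ρ) :=
  (ρ.continuous.comp continuous_subtype_val).subtype_mk _

-- The surface measure of `s` is a multiple of the volume of the cone over `s`, and an isometry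
-- carries cones to cones of equal volume.
open scoped Pointwise in
theorem measurePreserving_sphereMap {n : ℕ}
    (ρ : EuclideanSpace ℝ (Fin n) ≃ₗᵢ[ℝ] EuclideanSpace ℝ (Fin n)) :
    MeasurePreserving (sphereMap ρ) (sphereMeasure n) (sphereMeasure n) := by
  refine ⟨(continuous_sphereMap ρ).measurable, Measure.ext fun s hs => ?_⟩
  have hpre := (continuous_sphereMap ρ).measurable hs
  rw [Measure.map_apply (continuous_sphereMap ρ).measurable hs, sphereMeasure,
    Measure.toSphere_apply' _ hpre, Measure.toSphere_apply' _ hs]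
  congr 1
  rw [← ρ.measurePreserving.measure_preimage_emb ρ.toHomeomorph.measurableEmbedding
    (Set.Ioo (0 : ℝ) 1 • ((↑) '' s : Set (EuclideanSpace ℝ (Fin n))))]
  congr 1
  ext x
  simp only [Set.mem_preimage, Set.mem_smul, Set.mem_image]
  constructor
  · rintro ⟨c, hc, _, ⟨θ, hθ, rfl⟩, rfl⟩
    exact ⟨c, hc, _, ⟨_, hθ, rfl⟩, by simp [sphereMap]⟩
  · rintro ⟨c, hc, _, ⟨θ, hθ, rfl⟩, h⟩
    refine ⟨c, hc, _, ⟨sphereMap ρ.symm θ, ?_, rfl⟩, ?_⟩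
    · convert hθ
      ext1
      simp [sphereMap]
    · apply ρ.injective
      rw [← h]
      simp [sphereMap]

instance isFiniteMeasure_sphereMeasure (n : ℕ) : IsFiniteMeasure (sphereMeasure n) := by
  unfold sphereMeasure
  infer_instance

theorem sphereMeasure_real_univ_pos {n : ℕ} (hn : 2 ≤ n) :
    0 < (sphereMeasure n).real Set.univ := by
  have : Nontrivial (EuclideanSpace ℝ (Fin n)) := by
    apply Module.nontrivial_of_finrank_pos (R := ℝ)
    simp only [finrank_euclideanSpace, Fintype.card_fin]
    omega
  rw [Measure.real, ENNReal.toReal_pos_iff]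
  refine ⟨?_, measure_lt_top _ _⟩
  rw [pos_iff_ne_zero, Ne, Measure.measure_univ_eq_zero]
  exact Measure.toSphere_ne_zero _

open MvPolynomial in
theorem pderiv_bind₁ {σ τ R : Type*} [CommSemiring R] [Fintype σ]
    (L : σ → MvPolynomial τ R) (i : τ) (P : MvPolynomial σ R) :
    pderiv i (bind₁ L P) = ∑ j, bind₁ L (pderiv j P) * pderiv i (L j) := by
  classical
  induction P using MvPolynomial.induction_on with
  | C a => simp
  | add p q hp hq => simp [hp, hq, add_mul, Finset.sum_add_distrib]
  | mul_X p j hp =>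
    simp only [map_mul, bind₁_X_right, Derivation.leibniz, smul_eq_mul, hp, pderiv_X, map_add,
      add_mul, Finset.sum_add_distrib]
    congr 1
    · rw [Finset.sum_eq_single j]
      · simp
      · intro l _ hl
        simp [hl.symm]
      · simp
    · rw [Finset.mul_sum]
      refine Finset.sum_congr rfl fun l _ => ?_
      ring

theorem sum_apply_single_mul_apply_single {n : ℕ}
    (ρ : EuclideanSpace ℝ (Fin n) ≃ₗᵢ[ℝ] EuclideanSpace ℝ (Fin n)) (l j : Fin n) :
    ∑ i, ρ (EuclideanSpace.single i 1) l * ρ (EuclideanSpace.single i 1) j =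
      if l = j then 1 else 0 := by
  have h : ∀ i l, ρ (EuclideanSpace.single i 1) l = ρ.symm (EuclideanSpace.single l 1) i := by
    intro i l
    have h1 := ρ.inner_map_map (EuclideanSpace.single i 1) (ρ.symm (EuclideanSpace.single l 1))
    rw [ρ.apply_symm_apply, EuclideanSpace.inner_single_right, EuclideanSpace.inner_single_left]
      at h1
    simpa using h1
  have h2 := ρ.symm.inner_map_map (EuclideanSpace.single l (1 : ℝ)) (EuclideanSpace.single j 1)
  rw [EuclideanSpace.inner_single_left] at h2
  simp only [h]
  rw [PiLp.inner_apply] at h2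
  simp only [RCLike.inner_apply, conj_trivial, PiLp.single_apply] at h2
  rw [← Finset.sum_congr rfl fun i _ => mul_comm _ _, h2]
  simp

-- By the chain rule, an orthogonal substitution commutes with the Laplacian: the mixed second
-- derivatives get as coefficients the inner products of rows of an orthogonal matrix.
open MvPolynomial in
theorem sphericalHarmonics_comp_sphereMap {n k : ℕ}
    (ρ : EuclideanSpace ℝ (Fin n) ≃ₗᵢ[ℝ] EuclideanSpace ℝ (Fin n)) {f : UnitSphere n → ℝ}
    (hf : f ∈ sphericalHarmonics n k) : (fun θ => f (sphereMap ρ θ)) ∈ sphericalHarmonics n k := by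
  obtain ⟨P, hP, hΔ, hfP⟩ := hf
  set M : Fin n → Fin n → ℝ := fun i j => ρ (EuclideanSpace.single j 1) i with hM
  set L : Fin n → MvPolynomial (Fin n) ℝ := fun i => ∑ j, C (M i j) * X j with hL
  have hLi : ∀ i j, pderiv i (L j) = C (M j i) := fun i j => by
    classical
    simp only [hL, map_sum, pderiv_C_mul, pderiv_X]
    rw [Finset.sum_eq_single i]
    · simp
    · intro l _ hl
      simp [hl]
    · simp
  refine ⟨bind₁ L P, ?_, ?_, fun θ => ?_⟩
  · have := hP.aeval L (n := 1) fun i => IsHomogeneous.sum _ _ _ fun j _ => by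
      simpa using (isHomogeneous_C _ (M i j)).mul (isHomogeneous_X ℝ j)
    simpa using this
  · have h1 : ∀ i, pderiv i (pderiv i (bind₁ L P)) =
        ∑ j, ∑ l, bind₁ L (pderiv l (pderiv j P)) * C (M l i * M j i) := fun i => by
      simp only [pderiv_bind₁, hLi, map_sum]
      refine Finset.sum_congr rfl fun j _ => ?_
      rw [pderiv_mul, pderiv_C, mul_zero, add_zero, pderiv_bind₁, Finset.sum_mul]
      refine Finset.sum_congr rfl fun l _ => ?_
      rw [hLi, C_mul, mul_assoc]
    simp only [h1]
    rw [Finset.sum_comm]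
    have h2 : ∀ j, ∑ i, ∑ l, bind₁ L (pderiv l (pderiv j P)) * C (M l i * M j i) =
        bind₁ L (pderiv j (pderiv j P)) := fun j => by
      rw [Finset.sum_comm]
      simp only [← Finset.mul_sum, ← map_sum, hM, sum_apply_single_mul_apply_single]
      rw [Finset.sum_eq_single j]
      · simp
      · intro l _ hl
        simp [hl]
      · simp
    simp only [h2, ← map_sum, hΔ, map_zero]
  · refine (hfP _).trans ?_
    change _ = eval₂Hom (RingHom.id ℝ) _ (bind₁ L P)
    rw [eval₂Hom_bind₁]
    change eval₂Hom (RingHom.id ℝ) _ P = _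
    congr 2
    ext i
    have h3 : (θ.1 : EuclideanSpace ℝ (Fin n)) = ∑ j, θ.1 j • EuclideanSpace.single j (1 : ℝ) := by
      ext l
      simp [Pi.single_apply]
    simp only [sphereMap, hL, hM]
    conv_lhs => rw [h3]
    simp [mul_comm]

theorem IsSphericalHarmonicBasis.mem {n : ℕ} {a : ℕ → ℕ}
    {Y : (k : ℕ) → Fin (a k) → UnitSphere n → ℝ} (hY : IsSphericalHarmonicBasis n a Y) (k : ℕ)
    (l : Fin (a k)) : Y k l ∈ sphericalHarmonics n k := by
  rw [← hY.span_eq k]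
  exact Submodule.subset_span ⟨l, rfl⟩

theorem continuous_of_mem_sphericalHarmonics {n k : ℕ} {f : UnitSphere n → ℝ}
    (hf : f ∈ sphericalHarmonics n k) : Continuous f := by
  obtain ⟨P, -, -, h⟩ := hf
  rw [funext h]
  have : Continuous fun θ : UnitSphere n => fun i => θ.1 i := by fun_prop
  exact (MvPolynomial.continuous_eval P).comp this

theorem integrable_sphere_of_continuous {n : ℕ} {f : UnitSphere n → ℝ} (hf : Continuous f) :
    Integrable f (sphereMeasure n) :=
  hf.integrable_of_hasCompactSupport (HasCompactSupport.of_compactSpace f)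

section Reproducing

variable {n : ℕ} {a : ℕ → ℕ} {Y : (k : ℕ) → Fin (a k) → UnitSphere n → ℝ}

theorem IsSphericalHarmonicBasis.continuous (hY : IsSphericalHarmonicBasis n a Y) (k : ℕ)
    (l : Fin (a k)) : Continuous (Y k l) :=
  continuous_of_mem_sphericalHarmonics (hY.mem k l)

theorem IsSphericalHarmonicBasis.integral_sum_mul_self (hY : IsSphericalHarmonicBasis n a Y)
    (k : ℕ) (b c : Fin (a k) → ℝ) :
    ∫ θ, (∑ l, b l * Y k l θ) * (∑ l, c l * Y k l θ) ∂(sphereMeasure n) = ∑ l, b l * c l := by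
  have hI : ∀ l m, Integrable (fun θ => (b l * Y k l θ) * (c m * Y k m θ)) (sphereMeasure n) :=
    fun l m => integrable_sphere_of_continuous
      ((continuous_const.mul (hY.continuous k l)).mul (continuous_const.mul (hY.continuous k m)))
  simp only [Finset.sum_mul_sum]
  rw [integral_finsetSum _ fun l _ => integrable_finsetSum _ fun m _ => hI l m]
  refine Finset.sum_congr rfl fun l _ => ?_
  rw [integral_finsetSum _ fun m _ => hI l m]
  have : ∀ m, ∫ θ, (b l * Y k l θ) * (c m * Y k m θ) ∂(sphereMeasure n) =
      b l * c m * if l = m then 1 else 0 := fun m => by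
    rw [← hY.orthonormal, ← integral_const_mul]
    congr 1
    ext θ
    ring
  simp [this]

theorem IsSphericalHarmonicBasis.integral_kernel_mul (hY : IsSphericalHarmonicBasis n a Y)
    {k : ℕ} {f : UnitSphere n → ℝ} (hf : f ∈ sphericalHarmonics n k) (ψ : UnitSphere n) :
    ∫ θ, (∑ l, Y k l ψ * Y k l θ) * f θ ∂(sphereMeasure n) = f ψ := by
  rw [← hY.span_eq k, SetLike.mem_coe, Submodule.mem_span_range_iff_exists_fun] at hf
  obtain ⟨c, rfl⟩ := hf
  simp only [Finset.sum_apply, Pi.smul_apply, smul_eq_mul]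
  rw [hY.integral_sum_mul_self]
  exact Finset.sum_congr rfl fun l _ => mul_comm _ _

theorem IsSphericalHarmonicBasis.kernel_mem (hY : IsSphericalHarmonicBasis n a Y) (k : ℕ)
    (ψ : UnitSphere n) : (fun θ => ∑ l, Y k l ψ * Y k l θ) ∈ sphericalHarmonics n k := by
  rw [← hY.span_eq k, SetLike.mem_coe, Submodule.mem_span_range_iff_exists_fun]
  refine ⟨fun l => Y k l ψ, ?_⟩
  ext θ
  simp

/-- Let `Z(φ, x) = ∑ Y(φ) Y(x)` be the reproducing kernel and `ρ` the reflection that swaps `θ` and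
`ψ`. Reproduction gives `∫ Z(θ, x) Z(ψ, ρx) dx = Z(ψ, ψ)` and `∫ Z(ψ, x) Z(θ, ρx) dx = Z(θ, θ)`; the
substitution `x ↦ ρx` identifies the two integrals. -/
theorem IsSphericalHarmonicBasis.sum_sq_eq (hY : IsSphericalHarmonicBasis n a Y) (k : ℕ)
    (θ ψ : UnitSphere n) : ∑ l, Y k l θ ^ 2 = ∑ l, Y k l ψ ^ 2 := by
  have hnorm : ‖(θ.1 : EuclideanSpace ℝ (Fin n))‖ = ‖ψ.1‖ := by simp
  set ρ := Submodule.reflection (Submodule.span ℝ {θ.1 - ψ.1})ᗮ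
  have hρ : sphereMap ρ θ = ψ := Subtype.ext (Submodule.reflection_sub hnorm)
  have hinv : ∀ x, sphereMap ρ (sphereMap ρ x) = x := fun x =>
    Subtype.ext (Submodule.reflection_reflection _ _)
  have hρ' : sphereMap ρ ψ = θ := by
    rw [← hρ]
    exact hinv θ
  have h1 := hY.integral_kernel_mul (sphericalHarmonics_comp_sphereMap ρ (hY.kernel_mem k ψ)) θ
  have h2 := hY.integral_kernel_mul (sphericalHarmonics_comp_sphereMap ρ (hY.kernel_mem k θ)) ψ
  simp only [hρ, hρ'] at h1 h2
  simp only [pow_two]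
  rw [← h1, ← h2]
  have hc : ∀ φ : UnitSphere n, Continuous fun x => ∑ l, Y k l φ * Y k l x := fun φ =>
    continuous_finsetSum _ fun l _ => continuous_const.mul (hY.continuous k l)
  have h3 := integral_map (μ := sphereMeasure n) (continuous_sphereMap ρ).aemeasurable
    ((hc ψ).mul ((hc θ).comp (continuous_sphereMap ρ))).aestronglyMeasurable
  rw [(measurePreserving_sphereMap ρ).map_eq] at h3
  simp only [Function.comp_def, Pi.mul_apply, hinv] at h3
  rw [h3]
  simp only [mul_comm]

theorem IsSphericalHarmonicBasis.sum_sq_mul_measure (hY : IsSphericalHarmonicBasis n a Y) (k : ℕ)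
    (ψ : UnitSphere n) : (∑ l, Y k l ψ ^ 2) * (sphereMeasure n).real Set.univ = a k := by
  have h : ∫ θ, ∑ l, Y k l θ ^ 2 ∂(sphereMeasure n) = a k := by
    rw [integral_finsetSum _ fun l _ => integrable_sphere_of_continuous
      (f := fun θ => Y k l θ ^ 2) ((hY.continuous k l).pow 2)]
    simp [pow_two, hY.orthonormal]
  rw [← h, integral_congr_ae (Filter.Eventually.of_forall fun θ => hY.sum_sq_eq k θ ψ)]
  simp [mul_comm]

end Reproducing

/-! ### Dimension bound for the spherical harmonics -/

/-- The exponent vectors of degree `k` whose `0`-th entry is the number `t.1 ≤ 1`. -/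
noncomputable def smallExponent (N k : ℕ) (t : Fin 2 × (Fin N → Fin (k + 1))) : Fin (N + 2) →₀ ℕ :=
  -- The last entry is forced by the degree. Where the truncated subtraction cuts off, the vector
  -- may have the wrong degree; this only adds superfluous indices to the count.
  Finsupp.equivFunOnFinite.symm (Fin.cons (t.1 : ℕ)
    (Fin.snoc (fun i => (t.2 i : ℕ)) (k - t.1 - ∑ i, (t.2 i : ℕ)) : Fin (N + 1) → ℕ))

theorem exists_smallExponent_eq {N k : ℕ} {m : Fin (N + 2) →₀ ℕ} (hm : m.degree = k)
    (h0 : m 0 ≤ 1) : ∃ t, smallExponent N k t = m := by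
  have hsum : m 0 + (∑ i : Fin N, m i.castSucc.succ + m (Fin.last (N + 1))) = k := by
    rw [← hm, Finsupp.degree_eq_sum, Fin.sum_univ_succ, Fin.sum_univ_castSucc]
    rfl
  have hle : ∀ i : Fin N, m i.castSucc.succ < k + 1 := fun i => by
    have := Finset.single_le_sum (f := fun i : Fin N => m i.castSucc.succ)
      (fun _ _ => Nat.zero_le _) (Finset.mem_univ i)
    omega
  refine ⟨(⟨m 0, by omega⟩, fun i => ⟨m i.castSucc.succ, hle i⟩), ?_⟩
  ext j
  simp only [smallExponent, Finsupp.equivFunOnFinite_symm_apply_apply]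
  refine Fin.cases ?_ (fun j => ?_) j
  · simp
  · rw [Fin.cons_succ]
    refine Fin.lastCases ?_ (fun j => ?_) j
    · rw [Fin.snoc_last]
      change k - m 0 - ∑ i : Fin N, m i.castSucc.succ = m (Fin.last (N + 1))
      omega
    · rw [Fin.snoc_castSucc]

open MvPolynomial in
/-- A harmonic polynomial is determined by its coefficients of degree at most `1` in one of the
variables. -/
theorem eq_zero_of_coeff_smallExponent_eq_zero {N k : ℕ} {P : MvPolynomial (Fin (N + 2)) ℝ}
    (hP : P.IsHomogeneous k) (hΔ : ∑ i, pderiv i (pderiv i P) = 0)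
    (h : ∀ t, coeff (smallExponent N k t) P = 0) : P = 0 := by
  suffices H : ∀ (d : ℕ) (m : Fin (N + 2) →₀ ℕ), m 0 = d → coeff m P = 0 by
    ext m
    simpa using H _ m rfl
  intro d
  induction d using Nat.strong_induction_on with
  | _ d ih =>
    intro m hmd
    by_cases hdeg : m.degree = k
    swap
    · exact hP.coeff_eq_zero hdeg
    by_cases h1 : m 0 ≤ 1
    · obtain ⟨t, rfl⟩ := exists_smallExponent_eq hdeg h1
      exact h t
    set u : Fin (N + 2) →₀ ℕ := m - Finsupp.single 0 2 with hu
    have hmu : u + Finsupp.single 0 1 + Finsupp.single 0 1 = m := by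
      ext i
      by_cases hi : i = 0
      · subst hi
        simp [hu]
        omega
      · simp [hu, Ne.symm hi]
    have hu0 : u 0 + 2 = d := by
      rw [← hmd, ← hmu]
      simp
    -- The coefficient of `ΔP` at `u` expresses the coefficient of `P` at `m = u + 2e₀` through
    -- those at `u + 2eᵢ`, `i ≠ 0`, whose `0`-th exponent is `d - 2`; the latter vanish by
    -- induction.
    have hc := congrArg (coeff u) hΔ
    rw [coeff_sum, coeff_zero, Finset.sum_eq_single 0] at hc
    · rw [coeff_pderiv, coeff_pderiv, hmu] at hc
      have h2 : (u 0 : ℝ) + 1 + 1 ≠ 0 := by positivity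
      have h3 : (u 0 : ℝ) + 1 ≠ 0 := by positivity
      simpa [h2, h3] using hc
    · intro i _ hi
      rw [coeff_pderiv, coeff_pderiv, ih (u 0) (by omega), zero_mul, zero_mul]
      simp [hi]
    · simp

theorem IsSphericalHarmonicBasis.linearIndependent {n : ℕ} {a : ℕ → ℕ}
    {Y : (k : ℕ) → Fin (a k) → UnitSphere n → ℝ} (hY : IsSphericalHarmonicBasis n a Y) (k : ℕ) :
    LinearIndependent ℝ (Y k) := by
  rw [Fintype.linearIndependent_iff]
  intro c hc l
  have h := hY.integral_sum_mul_self k (fun m => if m = l then 1 else 0) c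
  have h0 : ∀ θ, ∑ m, c m * Y k m θ = 0 := fun θ => by
    have := congrFun hc θ
    simpa using this
  simpa [h0] using h.symm

/-- Polynomials representing the `Y k l` stay independent after restriction to the `2 (k + 1)^N`
coefficients of `smallExponent`: a relation between these coefficients is a relation between the
polynomials, hence between the functions on the sphere. -/
theorem IsSphericalHarmonicBasis.card_le {N : ℕ} {a : ℕ → ℕ}
    {Y : (k : ℕ) → Fin (a k) → UnitSphere (N + 2) → ℝ}
    (hY : IsSphericalHarmonicBasis (N + 2) a Y) (k : ℕ) : a k ≤ 2 * (k + 1) ^ N := by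
  choose P hP hΔ hPY using hY.mem k
  let Φ : MvPolynomial (Fin (N + 2)) ℝ →ₗ[ℝ] (Fin 2 × (Fin N → Fin (k + 1)) → ℝ) :=
    LinearMap.pi fun t => MvPolynomial.lcoeff ℝ (smallExponent N k t)
  have hli : LinearIndependent ℝ (fun l => Φ (P l)) := by
    rw [Fintype.linearIndependent_iff]
    intro c hc
    have hz : ∑ l, c l • P l = 0 := by
      refine eq_zero_of_coeff_smallExponent_eq_zero (k := k) ?_ ?_ fun t => ?_
      · refine MvPolynomial.IsHomogeneous.sum _ _ _ fun l _ => ?_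
        rw [MvPolynomial.smul_eq_C_mul]
        simpa using (MvPolynomial.isHomogeneous_C _ (c l)).mul (hP l)
      · simp only [map_sum, Derivation.map_smul]
        rw [Finset.sum_comm]
        simp only [← Finset.smul_sum, hΔ, smul_zero, Finset.sum_const_zero]
      · have := congrFun hc t
        simpa [Φ, MvPolynomial.coeff_sum] using this
    refine Fintype.linearIndependent_iff.1 (hY.linearIndependent k) c ?_
    ext θ
    have := congrArg (MvPolynomial.eval fun i => θ.1 i) hz
    simpa [hPY] using this
  have := hli.fintype_card_le_finrank
  simpa using this

/-! ### Sobolev summability and the kernel -/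

theorem summable_mul_of_sobolevSummable {a : ℕ → ℕ} {s : ℝ} {h g : (Σ k, Fin (a k)) → ℂ}
    (hh : SobolevSummable s h) (hg : SobolevSummable (-s) g) : Summable fun q => h q * g q := by
  refine Summable.of_norm_bounded (Summable.add hh hg) fun q => ?_
  have hw : (0 : ℝ) < 1 + (q.1 : ℝ) ^ 2 := by positivity
  set u := (1 + (q.1 : ℝ) ^ 2) ^ s with hu
  have hu0 : 0 < u := Real.rpow_pos_of_pos hw s
  rw [Real.rpow_neg hw.le, ← hu, norm_mul]
  -- Weighted arithmetic-geometric mean inequality, with the Sobolev weight as `u`.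
  have h1 : 0 ≤ u⁻¹ * (u * ‖h q‖ - ‖g q‖) ^ 2 := by positivity
  have h2 : u⁻¹ * (u * ‖h q‖ - ‖g q‖) ^ 2 =
      u * ‖h q‖ ^ 2 + u⁻¹ * ‖g q‖ ^ 2 - 2 * (‖h q‖ * ‖g q‖) := by
    field_simp
    ring
  nlinarith [mul_nonneg (norm_nonneg (h q)) (norm_nonneg (g q))]

/-- With `w = 1 + k²` and `k + 1 ≤ 2 √w`, the exponent of `w` is `s + N/2 = -(N + 1)/2 - ε`. The
surplus `N/2` is discarded, so the estimate is tight only for `N = 0`. -/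
theorem rpow_mul_pow_le {N k : ℕ} {s ε : ℝ} (hs : s = -((N + 2 : ℕ) : ℝ) + 3 / 2 - ε)
    (hk : 1 ≤ k) (hε : 0 < ε) :
    (1 + (k : ℝ) ^ 2) ^ s * ((k : ℝ) + 1) ^ N ≤ 2 ^ N * (k : ℝ) ^ (-1 - 2 * ε) := by
  have hk1 : (1 : ℝ) ≤ k := by exact_mod_cast hk
  have hk0 : (0 : ℝ) < k := by linarith
  set w : ℝ := 1 + (k : ℝ) ^ 2 with hw
  have hw1 : 1 ≤ w := by rw [hw]; nlinarith
  have hw0 : 0 < w := by linarith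
  have h1 : (k : ℝ) + 1 ≤ 2 * w ^ (1 / 2 : ℝ) := by
    rw [← Real.sqrt_eq_rpow]
    have := Real.le_sqrt_of_sq_le (show (((k : ℝ) + 1) / 2) ^ 2 ≤ w by rw [hw]; nlinarith)
    linarith
  calc w ^ s * ((k : ℝ) + 1) ^ N ≤ w ^ s * (2 * w ^ (1 / 2 : ℝ)) ^ N := by gcongr
    _ = 2 ^ N * w ^ (s + (1 / 2 : ℝ) * N) := by
      rw [mul_pow, ← Real.rpow_mul_natCast hw0.le, Real.rpow_add hw0]
      ring
    _ ≤ 2 ^ N * w ^ (-(1 / 2 + ε)) := by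
      gcongr
      rw [hs]
      push_cast
      have : (0 : ℝ) ≤ N := Nat.cast_nonneg N
      linarith
    _ ≤ 2 ^ N * ((k : ℝ) ^ 2) ^ (-(1 / 2 + ε)) := by
      gcongr ?_ * ?_
      exact Real.rpow_le_rpow_of_nonpos (by positivity) (by rw [hw]; linarith) (by linarith)
    _ = _ := by
      rw [← Real.rpow_natCast_mul hk0.le]
      congr 2
      push_cast
      ring

theorem sobolevSummable_radialShannon_mul {N p : ℕ} (hp : 1 ≤ p) {a : ℕ → ℕ}
    {Y : (k : ℕ) → Fin (a k) → UnitSphere (N + 2) → ℝ}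
    (hY : IsSphericalHarmonicBasis (N + 2) a Y) (r : ℝ) {ε : ℝ} (hε : 0 < ε)
    (ψ : UnitSphere (N + 2)) :
    SobolevSummable (-((N + 2 : ℕ) : ℝ) + 3 / 2 - ε)
      fun q : Σ k, Fin (a k) => radialShannon (N + 2) p q.1 r * (Y q.1 q.2 ψ : ℂ) := by
  set s := -((N + 2 : ℕ) : ℝ) + 3 / 2 - ε with hs
  obtain ⟨K, hK⟩ := exists_forall_norm_radialShannon_le (N + 2) p hp
  have hS := sphereMeasure_real_univ_pos (n := N + 2) (by omega)
  set A := (sphereMeasure (N + 2)).real Set.univ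
  rw [SobolevSummable, summable_sigma_of_nonneg fun q => by positivity]
  refine ⟨fun k => Summable.of_finite, ?_⟩
  have hsum : Summable fun k : ℕ => 8 * 2 ^ N / A * (k : ℝ) ^ (-1 - 2 * ε) :=
    (Real.summable_nat_rpow.2 (by linarith)).mul_left _
  refine Summable.of_norm_bounded_eventually_nat hsum ?_
  -- Finitely many degrees do not matter, since each degree contributes a finite sum; this covers
  -- the small `k` without a radial bound.
  filter_upwards [Filter.eventually_ge_atTop K, Filter.eventually_ge_atTop 1] with k hkK hk1
  have hZ : ∑ l, Y k l ψ ^ 2 ≤ 2 * ((k : ℝ) + 1) ^ N / A := by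
    rw [le_div_iff₀ hS, hY.sum_sq_mul_measure]
    exact_mod_cast hY.card_le k
  have hR : ‖radialShannon (N + 2) p k r‖ ^ 2 ≤ 4 := by
    nlinarith [hK k hkK r, norm_nonneg (radialShannon (N + 2) p k r)]
  rw [tsum_fintype, Real.norm_of_nonneg (Finset.sum_nonneg fun l _ => by positivity)]
  calc _ = (1 + (k : ℝ) ^ 2) ^ s * (‖radialShannon (N + 2) p k r‖ ^ 2 * ∑ l, Y k l ψ ^ 2) := by
        rw [Finset.mul_sum, Finset.mul_sum]
        refine Finset.sum_congr rfl fun l _ => ?_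
        rw [norm_mul, mul_pow, Complex.norm_real, Real.norm_eq_abs, sq_abs]
    _ ≤ (1 + (k : ℝ) ^ 2) ^ s * (4 * (2 * ((k : ℝ) + 1) ^ N / A)) := by
        gcongr
    _ = 8 / A * ((1 + (k : ℝ) ^ 2) ^ s * ((k : ℝ) + 1) ^ N) := by ring
    _ ≤ 8 / A * (2 ^ N * (k : ℝ) ^ (-1 - 2 * ε)) := by
        exact mul_le_mul_of_nonneg_left (rpow_mul_pow_le hs hk1 hε) (by positivity)
    _ = _ := by ring

theorem integral_shannonTerm_mul {n : ℕ} {a : ℕ → ℕ} {Y : (k : ℕ) → Fin (a k) → UnitSphere n → ℝ}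
    (hY : IsSphericalHarmonicBasis n a Y) (p : ℕ) (r : ℝ) (k : ℕ) (ψ : UnitSphere n)
    {g : UnitSphere n → ℂ} (hg : Integrable g (sphereMeasure n)) :
    ∫ θ, shannonTerm p Y r k θ ψ * g θ ∂(sphereMeasure n) =
      ∑ l, radialShannon n p k r * (Y k l ψ : ℂ) * sphereCoeff Y g ⟨k, l⟩ := by
  have hint : ∀ l, Integrable (fun θ => g θ * (Y k l θ : ℂ)) (sphereMeasure n) := fun l => by
    have hc : Continuous fun θ => (Y k l θ : ℂ) :=
      Complex.continuous_ofReal.comp (hY.continuous k l)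
    obtain ⟨C, hC⟩ := isCompact_univ.exists_bound_of_continuousOn hc.continuousOn
    exact hg.mul_bdd hc.aestronglyMeasurable (Filter.Eventually.of_forall fun θ => hC θ trivial)
  simp only [sphereCoeff, ← integral_const_mul]
  rw [← integral_finsetSum _ fun l _ => (hint l).const_mul _]
  congr 1
  ext θ
  rw [shannonTerm, Finset.sum_mul]
  refine Finset.sum_congr rfl fun l _ => ?_
  ring

theorem memSphereSobolev_shannonKernelFst {N p : ℕ} (hp : 1 ≤ p) {a : ℕ → ℕ}
    {Y : (k : ℕ) → Fin (a k) → UnitSphere (N + 2) → ℝ}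
    (hY : IsSphericalHarmonicBasis (N + 2) a Y) (r : ℝ) {ε : ℝ} (hε : 0 < ε)
    (ψ : UnitSphere (N + 2)) :
    MemSphereSobolev Y (-((N + 2 : ℕ) : ℝ) + 3 / 2 - ε) (shannonKernelFst p Y r ψ) := by
  have hh := sobolevSummable_radialShannon_mul hp hY r hε ψ
  refine ⟨_, hh, fun g hg2 hg => ?_⟩
  have hsum := summable_mul_of_sobolevSummable hh hg
  convert hsum.hasSum using 1
  -- Summability over all pairs `(k, ℓ)` allows grouping by degree, which is how the kernel is
  -- summed.
  rw [hsum.tsum_sigma, shannonKernelFst]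
  refine tsum_congr fun k => ?_
  rw [tsum_fintype, integral_shannonTerm_mul hY p r k ψ (hg2.integrable one_le_two)]

theorem shannonKernelSnd_eq {n p : ℕ} {a : ℕ → ℕ} (Y : (k : ℕ) → Fin (a k) → UnitSphere n → ℝ)
    (r : ℝ) : shannonKernelSnd p Y r = shannonKernelFst p Y r := by
  ext θ g
  simp only [shannonKernelSnd, shannonKernelFst, shannonTerm, mul_right_comm]

theorem mainTheorem9 (n p : ℕ) (hn : 2 ≤ n) (hp : 1 ≤ p) (a : ℕ → ℕ)
    (Y : (k : ℕ) → Fin (a k) → UnitSphere n → ℝ) (hY : IsSphericalHarmonicBasis n a Y)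
    (r : ℝ) (hr : 0 < r) (ε : ℝ) (hε : 0 < ε) :
    (∀ ψ : UnitSphere n,
      MemSphereSobolev Y (-(n : ℝ) + 3 / 2 - ε) (shannonKernelFst p Y r ψ)) ∧
    (∀ θ : UnitSphere n,
      MemSphereSobolev Y (-(n : ℝ) + 3 / 2 - ε) (shannonKernelSnd p Y r θ)) := by
  obtain ⟨N, rfl⟩ := Nat.exists_eq_add_of_le' hn
  rw [shannonKernelSnd_eq]
  exact ⟨memSphereSobolev_shannonKernelFst hp hY r hε, memSphereSobolev_shannonKernelFst hp hY r hε⟩
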